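/- **Theorem (Ganea sequence).** Let $\mathbb F$ be a field. A *Leibniz algebra* over $\mathbb F$ is an $\mathbb F$-vector space with a bilinear multiplication satisfying $x(yz)=(xy)z+y(xz)$; $L'$ denotes the span of all products $xy$ and $Z(L)=\{z\in L : xz=zx=0 \text{ for all } x\in L\}$. A *defining pair* for $L$ is a Leibniz algebra $K$ together with a surjective homomorphism $p:K\to L$ with $\ker p\subseteq Z(K)\cap K'$; it is *maximal* if $\dim K$ is maximal among all defining pairs for $L$, and then $K$ is called a cover of $L$ and $M(L)=\ker p$ the multiplier of $L$. Let $L$ be a finite-dimensional Leibniz algebra over $\mathbb F$, let $Z$ be a central ideal of $L$ (an ideal with $Z\subseteq Z(L)$), let $\pi:L\to L/Z$ be the natural map, and let $p_1:K_1\to L$ and $p_2:K_2\to L/Z$ be maximal defining pairs for $L$ and $L/Z$, so that $M(L)=\ker p_1$ and $M(L/Z)=\ker p_2$. Then there are linear maps $\theta,\beta,\gamma$ such that the sequence $$ (L/L'\otimes Z)\oplus (Z\otimes L/L') \xrightarrow{\ \theta\ } M(L)\xrightarrow{\ \beta\ } M(L/Z)\xrightarrow{\ \gamma\ } L'\cap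 Z\longrightarrow 0 $$ is exact, where the maps are the following natural ones: * for all $x,t\in K_1$ with $p_1(t)\in Z$, one has $\theta\big((p_1(x)+L')\otimes p_1(t),\,0\big)=xt$ and $\theta\big(0,\;p_1(t)\otimes (p_1(x)+L')\big)=tx$; * there is a homomorphism $b:K_1\to K_2$ with $p_2\circ b=\pi\circ p_1$, and $\beta$ is the restriction to $M(L)$ of every such $b$; * there is a homomorphism $c:K_2\to L$ with $\pi\circ c=p_2$, and $\gamma$ is the restriction to $M(L/Z)$ of every such $c$. -/

import Mathlib

open scoped TensorProduct

universe u v w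

/-- A (left) Leibniz algebra over a field `𝕜`: a `𝕜`-vector space with a bilinear multiplication
satisfying `x(yz) = (xy)z + y(xz)`. Additivity of the multiplication in each variable is part of
`NonUnitalNonAssocRing`; the two parent classes express its homogeneity in each variable. -/
class LeibnizAlgebra (𝕜 : Type u) (L : Type v) [Field 𝕜] [NonUnitalNonAssocRing L]
    [Module 𝕜 L] : Prop extends IsScalarTower 𝕜 L L, SMulCommClass 𝕜 L L where
  leibniz : ∀ x y z : L, x * (y * z) = (x * y) * z + y * (x * z)

namespace Leibniz

/-- The derived algebra `L' = LL`, the span of all products. -/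
def derived (𝕜 : Type u) (L : Type v) [Field 𝕜] [NonUnitalNonAssocRing L] [Module 𝕜 L] :
    Submodule 𝕜 L :=
  Submodule.span 𝕜 {p : L | ∃ x y : L, p = x * y}

/-- The center `Z(L) = {z | xz = zx = 0 for all x}`. -/
def center (𝕜 : Type u) (L : Type v) [Field 𝕜] [NonUnitalNonAssocRing L] [Module 𝕜 L]
    [LeibnizAlgebra 𝕜 L] : Submodule 𝕜 L where
  carrier := {z : L | ∀ x : L, x * z = 0 ∧ z * x = 0}
  zero_mem' := fun x => ⟨mul_zero x, zero_mul x⟩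
  add_mem' := fun {a b} ha hb x => by
    simp only [mul_add, add_mul, (ha x).1, (ha x).2, (hb x).1, (hb x).2, add_zero, and_self]
  smul_mem' := fun c z hz x => by
    simp only [mul_smul_comm, smul_mul_assoc, (hz x).1, (hz x).2, smul_zero, and_self]

/-- A (two-sided) ideal of a Leibniz algebra. -/
structure LIdeal (𝕜 : Type u) (L : Type v) [Field 𝕜] [NonUnitalNonAssocRing L]
    [Module 𝕜 L] extends Submodule 𝕜 L where
  mul_mem_left : ∀ (x : L) {y : L}, y ∈ carrier → x * y ∈ carrier
  mul_mem_right : ∀ {x : L} (y : L), x ∈ carrier → x * y ∈ carrier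

section Quotient

variable {𝕜 : Type u} {L : Type v} [Field 𝕜] [NonUnitalNonAssocRing L] [Module 𝕜 L]

/-- The quotient `L/I` of a Leibniz algebra by an ideal. -/
abbrev LQuot (I : LIdeal 𝕜 L) : Type v := L ⧸ I.toSubmodule

instance instMulQuot (I : LIdeal 𝕜 L) : Mul (LQuot I) where
  mul := Quotient.map₂ (· * ·) (by
    intro a a' ha b b' hb
    have ha' : a - a' ∈ I.toSubmodule := (Submodule.quotientRel_def _).1 ha
    have hb' : b - b' ∈ I.toSubmodule := (Submodule.quotientRel_def _).1 hb
    refine (Submodule.quotientRel_def _).2 ?_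
    have h : a * b - a' * b' = (a - a') * b + a' * (b - b') := by
      rw [sub_mul, mul_sub]; abel
    rw [h]
    exact I.toSubmodule.add_mem (I.mul_mem_right b ha') (I.mul_mem_left a' hb'))

theorem mk_mul (I : LIdeal 𝕜 L) (x y : L) :
    (Submodule.Quotient.mk (x * y) : LQuot I) =
      (Submodule.Quotient.mk x : LQuot I) * (Submodule.Quotient.mk y : LQuot I) := rfl

instance instRingQuot (I : LIdeal 𝕜 L) : NonUnitalNonAssocRing (LQuot I) where
  __ := (inferInstance : AddCommGroup (L ⧸ I.toSubmodule))
  __ := instMulQuot I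
  left_distrib := by
    rintro ⟨a⟩ ⟨b⟩ ⟨c⟩
    exact congrArg (Submodule.Quotient.mk (p := I.toSubmodule)) (mul_add a b c)
  right_distrib := by
    rintro ⟨a⟩ ⟨b⟩ ⟨c⟩
    exact congrArg (Submodule.Quotient.mk (p := I.toSubmodule)) (add_mul a b c)
  zero_mul := by
    rintro ⟨a⟩
    exact congrArg (Submodule.Quotient.mk (p := I.toSubmodule)) (zero_mul a)
  mul_zero := by
    rintro ⟨a⟩
    exact congrArg (Submodule.Quotient.mk (p := I.toSubmodule)) (mul_zero a)

instance instLeibnizQuot [LeibnizAlgebra 𝕜 L] (I : LIdeal 𝕜 L) : LeibnizAlgebra 𝕜 (LQuot I) where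
  smul_assoc := by
    rintro c ⟨a⟩ ⟨b⟩
    exact congrArg (Submodule.Quotient.mk (p := I.toSubmodule)) (smul_mul_assoc c a b)
  smul_comm := by
    rintro c ⟨a⟩ ⟨b⟩
    exact congrArg (Submodule.Quotient.mk (p := I.toSubmodule)) (mul_smul_comm c a b).symm
  leibniz := by
    rintro ⟨a⟩ ⟨b⟩ ⟨c⟩
    exact congrArg (Submodule.Quotient.mk (p := I.toSubmodule))
      (LeibnizAlgebra.leibniz 𝕜 a b c)

/-- The natural homomorphism `L → L/I`. -/
def mkHom (I : LIdeal 𝕜 L) : L →ₙₐ[𝕜] LQuot I where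
  toFun := Submodule.Quotient.mk
  map_smul' := fun _ _ => rfl
  map_zero' := rfl
  map_add' := fun _ _ => rfl
  map_mul' := fun _ _ => rfl

end Quotient

section Cover

variable {𝕜 : Type u} [Field 𝕜]

/-- The kernel of a homomorphism, as a subspace. -/
def ker {K : Type w} {L : Type v} [NonUnitalNonAssocRing K] [Module 𝕜 K]
    [NonUnitalNonAssocRing L] [Module 𝕜 L] (f : K →ₙₐ[𝕜] L) : Submodule 𝕜 K :=
  LinearMap.ker (f : K →ₗ[𝕜] L)

/-- `(K, ker f)` is a defining pair for `L`, the isomorphism `K / ker f ≅ L` being the one induced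
by the surjective homomorphism `f`: one has `ker f ⊆ Z(K) ∩ K'`. -/
structure IsDefiningPair {K : Type w} {L : Type v} [NonUnitalNonAssocRing K] [Module 𝕜 K]
    [LeibnizAlgebra 𝕜 K] [NonUnitalNonAssocRing L] [Module 𝕜 L] (f : K →ₙₐ[𝕜] L) : Prop where
  surjective : Function.Surjective f
  ker_le : ker f ≤ center 𝕜 K ⊓ derived 𝕜 K

/-- `(K, ker f)` is a maximal defining pair for `L`: the dimension of `K` is maximal among all
defining pairs. Then `K` is a cover of `L` and `ker f` is the multiplier `M(L)`. -/
structure IsMaximalDefiningPair {K : Type w} {L : Type v} [NonUnitalNonAssocRing K] [Module 𝕜 K]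
    [LeibnizAlgebra 𝕜 K] [NonUnitalNonAssocRing L] [Module 𝕜 L] (f : K →ₙₐ[𝕜] L) : Prop
    extends IsDefiningPair f where
  rank_le : ∀ (J : Type w) [NonUnitalNonAssocRing J] [Module 𝕜 J] [LeibnizAlgebra 𝕜 J]
    (g : J →ₙₐ[𝕜] L), IsDefiningPair g → Module.rank 𝕜 J ≤ Module.rank 𝕜 K

end Cover

section Existence

variable {𝕜 : Type u} [Field 𝕜] {L : Type v} [NonUnitalNonAssocRing L] [Module 𝕜 L]

theorem IsDefiningPair.exists_surjective {K : Type w} [NonUnitalNonAssocRing K]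
    [Module 𝕜 K] [LeibnizAlgebra 𝕜 K] {f : K →ₙₐ[𝕜] L} (hf : IsDefiningPair f) :
    ∃ φ : (L × (L ⊗[𝕜] L)) →ₗ[𝕜] K, Function.Surjective φ := by
  obtain ⟨s, hs⟩ := LinearMap.exists_rightInverse_of_surjective (f : K →ₗ[𝕜] L)
    (LinearMap.range_eq_top.2 hf.surjective)
  have hs' : ∀ x, f (s x) = x := fun x => LinearMap.congr_fun hs x
  let τ : L ⊗[𝕜] L →ₗ[𝕜] K := TensorProduct.lift ((LinearMap.mul 𝕜 K).compl₁₂ s s)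
  have hker : ∀ x : K, x - s (f x) ∈ ker f := fun x => by
    change f (x - s (f x)) = 0
    rw [map_sub, hs', sub_self]
  have hder : derived 𝕜 K ≤ LinearMap.range τ := by
    refine Submodule.span_le.2 ?_
    rintro _ ⟨x, y, rfl⟩
    refine ⟨f x ⊗ₜ f y, ?_⟩
    have hx := (hf.ker_le (hker x)).1
    have hy := (hf.ker_le (hker y)).1
    have h1 : x * y = s (f x) * y := by
      have := (hx y).2
      rwa [sub_mul, sub_eq_zero] at this
    have h2 : s (f x) * y = s (f x) * s (f y) := by
      have := (hy (s (f x))).1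
      rwa [mul_sub, sub_eq_zero] at this
    rw [h1, h2]
    simp [τ]
  refine ⟨s.coprod τ, fun x => ?_⟩
  obtain ⟨t, ht⟩ := hder (hf.ker_le (hker x)).2
  exact ⟨(f x, t), by rw [LinearMap.coprod_apply, ht]; abel⟩

/-- Every finite-dimensional Leibniz algebra has a maximal defining pair. -/
theorem exists_isMaximalDefiningPair [LeibnizAlgebra 𝕜 L] [FiniteDimensional 𝕜 L] :
    ∃ (K : Type (max u v)) (_ : NonUnitalNonAssocRing K) (_ : Module 𝕜 K)
      (_ : LeibnizAlgebra 𝕜 K) (f : K →ₙₐ[𝕜] L), IsMaximalDefiningPair f := by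
  let S : Set ℕ := {n | ∃ (K : Type (max u v)) (_ : NonUnitalNonAssocRing K) (_ : Module 𝕜 K)
      (_ : LeibnizAlgebra 𝕜 K) (f : K →ₙₐ[𝕜] L), IsDefiningPair f ∧ Module.finrank 𝕜 K = n}
  have hfin : ∀ (K : Type (max u v)) [NonUnitalNonAssocRing K] [Module 𝕜 K]
      [LeibnizAlgebra 𝕜 K] (f : K →ₙₐ[𝕜] L), IsDefiningPair f → FiniteDimensional 𝕜 K := by
    intro K _ _ _ f hf
    obtain ⟨φ, hφ⟩ := hf.exists_surjective
    exact Module.Finite.of_surjective φ hφ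
  have hne : S.Nonempty := by
    let _ : LeibnizAlgebra 𝕜 (ULift.{u} L) :=
      { smul_assoc := fun c x y => ULift.ext _ _ (smul_mul_assoc c x.down y.down)
        smul_comm := fun c x y => ULift.ext _ _ (mul_smul_comm c x.down y.down).symm
        leibniz := fun x y z => ULift.ext _ _ (LeibnizAlgebra.leibniz 𝕜 x.down y.down z.down) }
    let f : ULift.{u} L →ₙₐ[𝕜] L :=
      { toFun := ULift.down
        map_smul' := fun _ _ => rfl
        map_zero' := rfl
        map_add' := fun _ _ => rfl
        map_mul' := fun _ _ => rfl }
    refine ⟨_, ULift.{u} L, inferInstance, inferInstance, inferInstance, f, ⟨?_, ?_⟩, rfl⟩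
    · exact fun x => ⟨⟨x⟩, rfl⟩
    · intro x hx
      have : x = 0 := ULift.ext _ _ hx
      rw [this]
      exact Submodule.zero_mem _
  have hbdd : BddAbove S := by
    refine ⟨Module.finrank 𝕜 (L × (L ⊗[𝕜] L)), ?_⟩
    rintro _ ⟨K, _, _, _, f, hf, rfl⟩
    obtain ⟨φ, hφ⟩ := hf.exists_surjective
    exact LinearMap.finrank_le_finrank_of_surjective hφ
  obtain ⟨K, i1, i2, i3, f, hf, hK⟩ := Nat.sSup_mem hne hbdd
  refine ⟨K, i1, i2, i3, f, hf, ?_⟩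
  intro J _ _ _ g hg
  have := hfin K f hf
  have := hfin J g hg
  rw [← Module.finrank_eq_rank, ← Module.finrank_eq_rank, hK]
  exact_mod_cast le_csSup hbdd ⟨J, _, _, _, g, hg, rfl⟩

end Existence

end Leibniz

namespace Leibniz

/-! ### Homomorphisms modulo the center; central quotients -/

section Basic

variable {𝕜 : Type u} [Field 𝕜]
variable {K : Type*} [NonUnitalNonAssocRing K] [Module 𝕜 K]
variable {E : Type*} [NonUnitalNonAssocRing E] [Module 𝕜 E]
variable {L : Type*} [NonUnitalNonAssocRing L] [Module 𝕜 L]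

/-! Two principles carry the sequence. Since products ignore central summands, homomorphisms
agreeing modulo the center agree on the derived algebra, and one that is onto modulo the center is
onto on derived algebras. Multipliers lie in derived algebras, so every lift restricts to the same
map on them.

The second principle is that covers lift through central extensions
(`IsMaximalDefiningPair.exists_lift`). Pulling the extension back to the cover reduces this to
splitting a surjection `P → K` whose composite to the base has central kernel. Maximality forces the
kernel of `P → K` to miss `P'` (`IsMaximalDefiningPair.disjoint_ker_derived`), and a linear
complement containing `P'` is then a copy of `K`.

Lifting gives `b : K₁ → K₂` and `c : K₂ → L`. On `K₁'` one has `c ∘ b = p₁`, whence exactness at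
`M(L/Z)`; surjectivity of `γ` holds because `c` maps `K₂'` onto `L'`. For exactness at `M(L)`,
dividing `K₁` by the image of `θ` makes it a central extension of `L/Z`; lifting `K₂` into it shows
that `ker β` dies in the quotient. -/

theorem mem_ker {f : K →ₙₐ[𝕜] L} {x : K} : x ∈ ker f ↔ f x = 0 := Iff.rfl

theorem mul_mem_derived (x y : K) : x * y ∈ derived 𝕜 K :=
  Submodule.subset_span ⟨x, y, rfl⟩

theorem map_mem_derived (f : K →ₙₐ[𝕜] L) {x : K} (hx : x ∈ derived 𝕜 K) :
    f x ∈ derived 𝕜 L := by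
  have h : derived 𝕜 K ≤ (derived 𝕜 L).comap (f : K →ₗ[𝕜] L) := by
    refine Submodule.span_le.2 ?_
    rintro _ ⟨x, y, rfl⟩
    change f (x * y) ∈ derived 𝕜 L
    rw [map_mul]
    exact mul_mem_derived _ _
  exact h hx

/-- Products in a Leibniz algebra only depend on the factors modulo the center. -/
theorem mul_eq_mul_of_sub_mem_center [LeibnizAlgebra 𝕜 K] {x x' y y' : K}
    (hx : x - x' ∈ center 𝕜 K) (hy : y - y' ∈ center 𝕜 K) : x * y = x' * y' := by
  have h1 := (hx y).2
  have h2 := (hy x').1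
  rw [sub_mul, sub_eq_zero] at h1
  rw [mul_sub, sub_eq_zero] at h2
  rw [h1, h2]

/-- Homomorphisms that agree modulo the center agree on the derived algebra. -/
theorem eqOn_derived [LeibnizAlgebra 𝕜 E] (f g : K →ₙₐ[𝕜] E)
    (h : ∀ x, f x - g x ∈ center 𝕜 E) {x : K} (hx : x ∈ derived 𝕜 K) : f x = g x := by
  have h' : derived 𝕜 K ≤ LinearMap.eqLocus (f : K →ₗ[𝕜] E) (g : K →ₗ[𝕜] E) := by
    refine Submodule.span_le.2 ?_
    rintro _ ⟨x, y, rfl⟩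
    change f (x * y) = g (x * y)
    rw [map_mul, map_mul]
    exact mul_eq_mul_of_sub_mem_center (h x) (h y)
  exact h' hx

/-- A homomorphism that is surjective modulo the center is surjective on derived algebras. -/
theorem exists_mem_derived_map_eq [LeibnizAlgebra 𝕜 E] (f : K →ₙₐ[𝕜] E)
    (h : ∀ y, ∃ x, y - f x ∈ center 𝕜 E) {y : E} (hy : y ∈ derived 𝕜 E) :
    ∃ x ∈ derived 𝕜 K, f x = y := by
  have h' : derived 𝕜 E ≤ (derived 𝕜 K).map (f : K →ₗ[𝕜] E) := by
    refine Submodule.span_le.2 ?_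
    rintro _ ⟨x, y, rfl⟩
    obtain ⟨a, ha⟩ := h x
    obtain ⟨b, hb⟩ := h y
    refine ⟨a * b, mul_mem_derived a b, ?_⟩
    change f (a * b) = x * y
    rw [map_mul]
    exact (mul_eq_mul_of_sub_mem_center ha hb).symm
  exact h' hy

/-- A subspace of the center, as an ideal. -/
def centralIdeal [LeibnizAlgebra 𝕜 K] (S : Submodule 𝕜 K) (hS : S ≤ center 𝕜 K) :
    LIdeal 𝕜 K where
  __ := S
  mul_mem_left x y hy := by
    rw [(hS hy x).1]
    exact S.zero_mem
  mul_mem_right y hx := by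
    rw [(hS hx y).2]
    exact S.zero_mem

/-- The homomorphism induced on a quotient. -/
def liftHom (I : LIdeal 𝕜 K) (f : K →ₙₐ[𝕜] L) (h : I.toSubmodule ≤ ker f) :
    LQuot I →ₙₐ[𝕜] L where
  toFun := I.toSubmodule.liftQ (f : K →ₗ[𝕜] L) h
  map_smul' := map_smul _
  map_zero' := map_zero _
  map_add' := map_add _
  map_mul' := by
    rintro ⟨x⟩ ⟨y⟩
    exact map_mul f x y

theorem mkHom_eq_zero {I : LIdeal 𝕜 K} {x : K} : mkHom I x = 0 ↔ x ∈ I.toSubmodule :=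
  Submodule.Quotient.mk_eq_zero _

theorem mkHom_surjective (I : LIdeal 𝕜 K) : Function.Surjective (mkHom I) :=
  Submodule.Quotient.mk_surjective _

theorem IsDefiningPair.finiteDimensional [LeibnizAlgebra 𝕜 K] [FiniteDimensional 𝕜 L]
    {f : K →ₙₐ[𝕜] L} (hf : IsDefiningPair f) : FiniteDimensional 𝕜 K := by
  obtain ⟨φ, hφ⟩ := hf.exists_surjective
  exact Module.Finite.of_surjective φ hφ

theorem IsDefiningPair.mul_congr [LeibnizAlgebra 𝕜 K] {p : K →ₙₐ[𝕜] L}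
    (hp : IsDefiningPair p) {x x' y y' : K} (hx : p x = p x') (hy : p y = p y') : x * y = x' * y' :=
  mul_eq_mul_of_sub_mem_center
    (hp.ker_le (by rw [mem_ker, map_sub, hx, sub_self])).1
    (hp.ker_le (by rw [mem_ker, map_sub, hy, sub_self])).1

end Basic

/-! ### Lifting property of covers -/

section Lift

variable {𝕜 : Type u} [Field 𝕜]

/-- Dividing `P` by a complement of `ker f ∩ P'` in `ker f` yields another defining pair for `L`,
still mapping onto `K`. By maximality it is no larger than `K`, so the part of `ker f` inside `P'`
must vanish. -/
theorem IsMaximalDefiningPair.disjoint_ker_derived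
    {L : Type v} [NonUnitalNonAssocRing L] [Module 𝕜 L] [FiniteDimensional 𝕜 L]
    {K P : Type w} [NonUnitalNonAssocRing K] [Module 𝕜 K] [LeibnizAlgebra 𝕜 K]
    [NonUnitalNonAssocRing P] [Module 𝕜 P] [LeibnizAlgebra 𝕜 P]
    {p : K →ₙₐ[𝕜] L} (hp : IsMaximalDefiningPair p) (f : P →ₙₐ[𝕜] K)
    (hf : Function.Surjective f) (hc : ker (p.comp f) ≤ center 𝕜 P) :
    Disjoint (ker f) (derived 𝕜 P) := by
  have hkf : ker f ≤ center 𝕜 P := fun x hx => hc <| by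
    change p (f x) = 0
    rw [mem_ker.1 hx, map_zero]
  obtain ⟨S', hS'⟩ := Submodule.exists_isCompl ((derived 𝕜 P).comap (ker f).subtype)
  let S : Submodule 𝕜 P := S'.map (ker f).subtype
  have hS : S ≤ ker f := Submodule.map_subtype_le _ _
  let I := centralIdeal S (hS.trans hkf)
  let g : LQuot I →ₙₐ[𝕜] K := liftHom I f hS
  have hg : Function.Surjective g := fun k => by
    obtain ⟨x, rfl⟩ := hf k
    exact ⟨mkHom I x, rfl⟩
  have hpair : IsDefiningPair (p.comp g) := by
    refine ⟨hp.surjective.comp hg, ?_⟩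
    rintro ⟨x⟩ hx
    change p (f x) = 0 at hx
    refine ⟨?_, ?_⟩
    · rintro ⟨y⟩
      have h := hc (show x ∈ ker (p.comp f) from hx) y
      exact ⟨congrArg (mkHom I) h.1, congrArg (mkHom I) h.2⟩
    -- Here `f x` lies in `ker p ⊆ K'`, so it is the image of some `d` in `P'`. The difference `x -
    -- d` lies in `ker f` and splits into a derived part `a` and a part in `S`, so `x` is congruent
    -- to `d + a` modulo `S`.
    · obtain ⟨d, hd, hdx⟩ := exists_mem_derived_map_eq f
        (fun y => ⟨(hf y).choose, by rw [(hf y).choose_spec, sub_self]; exact zero_mem _⟩)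
        (hp.ker_le hx).2
      have hxd : x - d ∈ ker f := by
        rw [mem_ker, map_sub, hdx, sub_self]
      have hsup : (⟨x - d, hxd⟩ : ker f) ∈ (derived 𝕜 P).comap (ker f).subtype ⊔ S' := by
        rw [hS'.sup_eq_top]
        exact Submodule.mem_top
      obtain ⟨a, ha, s, hs, has⟩ := Submodule.mem_sup.1 hsup
      have hx' : x - (d + a) ∈ I.toSubmodule := by
        have h : (a : P) + s = x - d := congrArg Subtype.val has
        have h' : x - (d + a) = s := by
          rw [← sub_sub, ← h, add_sub_cancel_left]
        rw [h']
        exact ⟨s, hs, rfl⟩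
      have h2 : mkHom I x = mkHom I (d + a) := by
        rw [← sub_eq_zero, ← map_sub, mkHom_eq_zero]
        exact hx'
      change mkHom I x ∈ _
      rw [h2]
      exact map_mem_derived _ (add_mem hd ha)
  have := hp.toIsDefiningPair.finiteDimensional
  have := hpair.finiteDimensional
  have hrank : Module.finrank 𝕜 (LQuot I) = Module.finrank 𝕜 K := by
    refine le_antisymm ?_ ?_
    · have h := hp.rank_le (LQuot I) (p.comp g) hpair
      rw [← Module.finrank_eq_rank, ← Module.finrank_eq_rank] at h
      exact_mod_cast h
    · exact LinearMap.finrank_le_finrank_of_surjective (f := (g : LQuot I →ₗ[𝕜] K)) hg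
  -- A surjection between spaces of equal finite dimension is injective; hence `ker f = S`, which
  -- meets `P'` trivially.
  have hinj : Function.Injective (g : LQuot I →ₗ[𝕜] K) :=
    (LinearMap.injective_iff_surjective_of_finrank_eq_finrank hrank).2 hg
  refine Submodule.disjoint_def.2 fun x hx hxd => ?_
  have hxS : x ∈ S := by
    have h : mkHom I x = 0 := hinj (by rw [map_zero]; exact hx)
    exact mkHom_eq_zero.1 h
  obtain ⟨s, hs, rfl⟩ := hxS
  have h := Submodule.disjoint_def.1 hS'.disjoint s hxd hs
  rw [h, map_zero]

/-- A central extension of a cover that stays central over the base algebra splits. -/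
theorem IsMaximalDefiningPair.exists_section
    {L : Type v} [NonUnitalNonAssocRing L] [Module 𝕜 L] [FiniteDimensional 𝕜 L]
    {K P : Type w} [NonUnitalNonAssocRing K] [Module 𝕜 K] [LeibnizAlgebra 𝕜 K]
    [NonUnitalNonAssocRing P] [Module 𝕜 P] [LeibnizAlgebra 𝕜 P]
    {p : K →ₙₐ[𝕜] L} (hp : IsMaximalDefiningPair p) (f : P →ₙₐ[𝕜] K)
    (hf : Function.Surjective f) (hc : ker (p.comp f) ≤ center 𝕜 P) :
    ∃ σ : K →ₙₐ[𝕜] P, ∀ x, f (σ x) = x := by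
  -- Choosing the complement `D` of `ker f` to contain `P'` makes it closed under products, so the
  -- inverse of `f` on `D` is multiplicative.
  obtain ⟨D, hD, hDc⟩ := (hp.disjoint_ker_derived f hf hc).symm.exists_isCompl
  have hinj : ∀ x ∈ D, ∀ y ∈ D, f x = f y → x = y := fun x hx y hy h => by
    rw [← sub_eq_zero]
    refine Submodule.disjoint_def.1 hDc.disjoint _ (sub_mem hx hy) ?_
    rw [mem_ker, map_sub, h, sub_self]
  have hsurj : ∀ k : K, ∃ x ∈ D, f x = k := fun k => by
    obtain ⟨y, rfl⟩ := hf k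
    have hy : y ∈ D ⊔ ker f := by
      rw [hDc.sup_eq_top]
      exact Submodule.mem_top
    obtain ⟨d, hd, z, hz, rfl⟩ := Submodule.mem_sup.1 hy
    exact ⟨d, hd, by rw [map_add, mem_ker.1 hz, add_zero]⟩
  choose σ hσD hσ using hsurj
  refine ⟨{ toFun := σ, map_smul' := ?_, map_zero' := ?_, map_add' := ?_, map_mul' := ?_ }, hσ⟩
  · intro c x
    refine hinj _ (hσD _) _ (D.smul_mem c (hσD x)) ?_
    rw [hσ, map_smul, hσ]
    rfl
  · refine hinj _ (hσD _) _ D.zero_mem ?_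
    rw [hσ, map_zero]
  · intro x y
    refine hinj _ (hσD _) _ (D.add_mem (hσD x) (hσD y)) ?_
    rw [hσ, map_add, hσ, hσ]
  · intro x y
    refine hinj _ (hσD _) _ (hD (mul_mem_derived _ _)) ?_
    rw [hσ, map_mul, hσ, hσ]

/-- Covers have the lifting property with respect to central extensions. -/
theorem IsMaximalDefiningPair.exists_lift
    {L : Type*} [NonUnitalNonAssocRing L] [Module 𝕜 L] [FiniteDimensional 𝕜 L]
    {E : Type v} {K : Type (max v w)}
    [NonUnitalNonAssocRing K] [Module 𝕜 K] [LeibnizAlgebra 𝕜 K]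
    [NonUnitalNonAssocRing E] [Module 𝕜 E] [LeibnizAlgebra 𝕜 E]
    {Q : Type*} [NonUnitalNonAssocRing Q] [Module 𝕜 Q]
    {p : K →ₙₐ[𝕜] L} (hp : IsMaximalDefiningPair p)
    (q : E →ₙₐ[𝕜] Q) (hq : Function.Surjective q) (hc : ker q ≤ center 𝕜 E)
    (φ : L →ₙₐ[𝕜] Q) :
    ∃ b : K →ₙₐ[𝕜] E, ∀ x, q (b x) = φ (p x) := by
  -- The fibre product of `K` and `E` over `Q`. The universe of `K` absorbs that of `E`, so `P` is
  -- in the range of the maximality of `p`.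
  let P : NonUnitalSubalgebra 𝕜 (K × E) :=
    { carrier := {x | q x.2 = φ (p x.1)}
      zero_mem' := by simp
      add_mem' := fun {x y} hx hy => by
        simp only [Set.mem_ofPred_eq] at hx hy ⊢
        simp [hx, hy]
      mul_mem' := fun {x y} hx hy => by
        simp only [Set.mem_ofPred_eq] at hx hy ⊢
        simp [hx, hy]
      smul_mem' := fun c x hx => by
        simp only [Set.mem_ofPred_eq] at hx ⊢
        simp [hx] }
  let _ : LeibnizAlgebra 𝕜 P :=
    { smul_assoc := fun c x y => Subtype.ext (Prod.ext
        (smul_mul_assoc c x.1.1 y.1.1) (smul_mul_assoc c x.1.2 y.1.2))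
      smul_comm := fun c x y => Subtype.ext (Prod.ext
        (mul_smul_comm c x.1.1 y.1.1).symm (mul_smul_comm c x.1.2 y.1.2).symm)
      leibniz := fun x y z => Subtype.ext (Prod.ext
        (LeibnizAlgebra.leibniz 𝕜 x.1.1 y.1.1 z.1.1)
        (LeibnizAlgebra.leibniz 𝕜 x.1.2 y.1.2 z.1.2)) }
  let f : P →ₙₐ[𝕜] K := (NonUnitalAlgHom.fst 𝕜 K E).comp (NonUnitalSubalgebraClass.subtype P)
  let g : P →ₙₐ[𝕜] E := (NonUnitalAlgHom.snd 𝕜 K E).comp (NonUnitalSubalgebraClass.subtype P)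
  have hf : Function.Surjective f := fun k => by
    obtain ⟨e, he⟩ := hq (φ (p k))
    exact ⟨⟨(k, e), he⟩, rfl⟩
  have hcen : ker (p.comp f) ≤ center 𝕜 P := by
    rintro ⟨⟨k, e⟩, hke⟩ hx ⟨⟨k', e'⟩, hke'⟩
    change p k = 0 at hx
    change q e = φ (p k) at hke
    have hk := (hp.ker_le (mem_ker.2 hx)).1 k'
    have he := hc (mem_ker.2 (by rw [hke, hx, map_zero])) e'
    exact ⟨Subtype.ext (Prod.ext hk.1 he.1), Subtype.ext (Prod.ext hk.2 he.2)⟩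
  obtain ⟨σ, hσ⟩ := hp.exists_section f hf hcen
  refine ⟨g.comp σ, fun x => ?_⟩
  have h : q (g (σ x)) = φ (p (f (σ x))) := (σ x).2
  rwa [hσ] at h

end Lift

/-! ### The multiplication map `θ` -/

section Ganea

variable {𝕜 : Type u} [Field 𝕜]
variable {L : Type v} [NonUnitalNonAssocRing L] [Module 𝕜 L] [LeibnizAlgebra 𝕜 L]
variable {K : Type w} [NonUnitalNonAssocRing K] [Module 𝕜 K] [LeibnizAlgebra 𝕜 K]

/-- In a defining pair for `L`, derived elements annihilate the preimage of the center of `L`. -/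
theorem IsDefiningPair.mul_eq_zero_of_mem_derived {p : K →ₙₐ[𝕜] L} (hp : IsDefiningPair p)
    {x t : K} (hx : x ∈ derived 𝕜 K) (ht : p t ∈ center 𝕜 L) : x * t = 0 ∧ t * x = 0 := by
  -- As `p t` is central, `a * t` and `t * a` lie in `ker p`, hence in the center of `K`. The
  -- Leibniz identity then kills `(a * b) * t` and `t * (a * b)`.
  have hl : ∀ a : K, a * t ∈ center 𝕜 K := fun a =>
    (hp.ker_le (by rw [mem_ker, map_mul, (ht _).1])).1
  have hr : ∀ a : K, t * a ∈ center 𝕜 K := fun a =>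
    (hp.ker_le (by rw [mem_ker, map_mul, (ht _).2])).1
  have h : derived 𝕜 K ≤ LinearMap.ker ((LinearMap.mul 𝕜 K).flip t) ⊓
      LinearMap.ker (LinearMap.mul 𝕜 K t) := by
    refine Submodule.span_le.2 ?_
    rintro _ ⟨a, b, rfl⟩
    constructor
    · change a * b * t = 0
      have h := LeibnizAlgebra.leibniz 𝕜 a b t
      rw [(hl b a).1, (hl a b).1, add_zero] at h
      exact h.symm
    · change t * (a * b) = 0
      rw [LeibnizAlgebra.leibniz 𝕜 t a b, (hr a b).2, (hr b a).1, add_zero]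
  exact h hx

/-- The map induced on tensor products by the multiplication of a defining pair. -/
theorem IsDefiningPair.exists_ganeaMap {p : K →ₙₐ[𝕜] L} (hp : IsDefiningPair p)
    (Z : Submodule 𝕜 L) (hZ : Z ≤ center 𝕜 L) :
    ∃ θ : ((L ⧸ derived 𝕜 L) ⊗[𝕜] Z) × (Z ⊗[𝕜] (L ⧸ derived 𝕜 L)) →ₗ[𝕜] ker p,
      ∀ (x t : K) (ht : p t ∈ Z),
        (θ (Submodule.Quotient.mk (p x) ⊗ₜ[𝕜] ⟨p t, ht⟩, 0) : K) = x * t ∧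
        (θ (0, ⟨p t, ht⟩ ⊗ₜ[𝕜] Submodule.Quotient.mk (p x)) : K) = t * x := by
  -- A linear section makes the products bilinear; since `ker p` is central they do not depend on
  -- its choice.
  obtain ⟨s, hs⟩ := LinearMap.exists_rightInverse_of_surjective (p : K →ₗ[𝕜] L)
    (LinearMap.range_eq_top.2 hp.surjective)
  have hs' : ∀ x, p (s x) = x := fun x => LinearMap.congr_fun hs x
  let B₁ : L →ₗ[𝕜] Z →ₗ[𝕜] ker p := LinearMap.mk₂ 𝕜
    (fun l z => ⟨s l * s z, by rw [mem_ker, map_mul, hs', hs', (hZ z.2 l).1]⟩)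
    (fun _ _ _ => Subtype.ext (by simp [add_mul]))
    (fun _ _ _ => Subtype.ext (by simp [smul_mul_assoc]))
    (fun _ _ _ => Subtype.ext (by simp [mul_add]))
    (fun _ _ _ => Subtype.ext (by simp [mul_smul_comm]))
  let B₂ : L →ₗ[𝕜] Z →ₗ[𝕜] ker p := LinearMap.mk₂ 𝕜
    (fun l z => ⟨s z * s l, by rw [mem_ker, map_mul, hs', hs', (hZ z.2 l).2]⟩)
    (fun _ _ _ => Subtype.ext (by simp [mul_add]))
    (fun _ _ _ => Subtype.ext (by simp [mul_smul_comm]))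
    (fun _ _ _ => Subtype.ext (by simp [add_mul]))
    (fun _ _ _ => Subtype.ext (by simp [smul_mul_assoc]))
  have hd : ∀ l ∈ derived 𝕜 L, ∀ z : Z, s l * s z = 0 ∧ s z * s l = 0 := by
    intro l hl z
    obtain ⟨k, hk, rfl⟩ := exists_mem_derived_map_eq p
      (fun y => ⟨s y, by rw [hs', sub_self]; exact zero_mem _⟩) hl
    have h := hp.mul_eq_zero_of_mem_derived (t := s z) hk (by rw [hs']; exact hZ z.2)
    exact ⟨(hp.mul_congr (hs' _) rfl).trans h.1, (hp.mul_congr rfl (hs' _)).trans h.2⟩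
  have h₁ : derived 𝕜 L ≤ LinearMap.ker B₁ := fun l hl =>
    LinearMap.ext fun z => Subtype.ext (hd l hl z).1
  have h₂ : derived 𝕜 L ≤ LinearMap.ker B₂ := fun l hl =>
    LinearMap.ext fun z => Subtype.ext (hd l hl z).2
  -- `B₂` takes its argument from `L` first so that it descends to `L/L'`; `flip` restores the order
  -- of the factors.
  refine ⟨(TensorProduct.lift ((derived 𝕜 L).liftQ B₁ h₁)).coprod
    (TensorProduct.lift ((derived 𝕜 L).liftQ B₂ h₂).flip), fun x t ht => ⟨?_, ?_⟩⟩
  · have h : s (p x) * s (p t) = x * t := hp.mul_congr (hs' _) (hs' _)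
    simpa [B₁] using h
  · have h : s (p t) * s (p x) = t * x := hp.mul_congr (hs' _) (hs' _)
    simpa [B₂] using h

end Ganea

end Leibniz

/-! ### The Ganea sequence -/

open Leibniz in
theorem mainTheorem4 {𝕜 : Type u} [Field 𝕜]
    {L : Type v} [NonUnitalNonAssocRing L] [Module 𝕜 L] [LeibnizAlgebra 𝕜 L]
    [FiniteDimensional 𝕜 L]
    (Z : LIdeal 𝕜 L) (hZ : Z.toSubmodule ≤ center 𝕜 L)
    -- a maximal defining pair for `L`, so that `ker p₁` is `M(L)`
    {K₁ : Type (max u v)} [NonUnitalNonAssocRing K₁] [Module 𝕜 K₁] [LeibnizAlgebra 𝕜 K₁]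
    (p₁ : K₁ →ₙₐ[𝕜] L) (h₁ : IsMaximalDefiningPair p₁)
    -- a maximal defining pair for `L/Z`, so that `ker p₂` is `M(L/Z)`
    {K₂ : Type (max u v)} [NonUnitalNonAssocRing K₂] [Module 𝕜 K₂] [LeibnizAlgebra 𝕜 K₂]
    (p₂ : K₂ →ₙₐ[𝕜] LQuot Z) (h₂ : IsMaximalDefiningPair p₂) :
    ∃ (θ : ((L ⧸ derived 𝕜 L) ⊗[𝕜] Z.toSubmodule) × (Z.toSubmodule ⊗[𝕜] (L ⧸ derived 𝕜 L))
          →ₗ[𝕜] ker p₁)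
      (β : ker p₁ →ₗ[𝕜] ker p₂)
      (γ : ker p₂ →ₗ[𝕜] (derived 𝕜 L ⊓ Z.toSubmodule : Submodule 𝕜 L)),
      -- `θ` is induced by the multiplication of the cover `K₁`
      (∀ (x t : K₁) (ht : p₁ t ∈ Z.toSubmodule),
        (θ (Submodule.Quotient.mk (p₁ x) ⊗ₜ[𝕜] ⟨p₁ t, ht⟩, 0) : K₁) = x * t ∧
        (θ (0, ⟨p₁ t, ht⟩ ⊗ₜ[𝕜] Submodule.Quotient.mk (p₁ x)) : K₁) = t * x) ∧
      -- `β` is the restriction of any homomorphism of covers over `L → L/Z`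
      (∃ b : K₁ →ₙₐ[𝕜] K₂, p₂.comp b = (mkHom Z).comp p₁) ∧
      (∀ b : K₁ →ₙₐ[𝕜] K₂, p₂.comp b = (mkHom Z).comp p₁ →
        ∀ m : ker p₁, (β m : K₂) = b m) ∧
      -- `γ` is the restriction of any homomorphism `K₂ → L` over `L/Z`
      (∃ c : K₂ →ₙₐ[𝕜] L, (mkHom Z).comp c = p₂) ∧
      (∀ c : K₂ →ₙₐ[𝕜] L, (mkHom Z).comp c = p₂ →
        ∀ m : ker p₂, (γ m : L) = c m) ∧
      -- exactness
      Function.Exact θ β ∧ Function.Exact β γ ∧ Function.Surjective γ := by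
  have hmk : ∀ {x : L}, mkHom Z x = 0 ↔ x ∈ Z.toSubmodule := mkHom_eq_zero
  have hkmk : ker (mkHom Z) ≤ center 𝕜 L := fun x hx => hZ (hmk.1 hx)
  have hk₂ : ker p₂ ≤ center 𝕜 K₂ := fun x hx => (h₂.ker_le hx).1
  obtain ⟨b, hb⟩ := IsMaximalDefiningPair.exists_lift.{u, max u v, u} h₁ p₂ h₂.surjective hk₂
    (mkHom Z)
  obtain ⟨c, hc⟩ := IsMaximalDefiningPair.exists_lift.{u, v, u} h₂ (mkHom Z)
    (mkHom_surjective Z) hkmk (NonUnitalAlgHom.id 𝕜 (LQuot Z))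
  replace hc : ∀ x, mkHom Z (c x) = p₂ x := hc
  obtain ⟨θ, hθ⟩ := h₁.toIsDefiningPair.exists_ganeaMap Z.toSubmodule hZ
  have hbker : ∀ m ∈ ker p₁, b m ∈ ker p₂ := fun m hm => by
    rw [mem_ker, hb, mem_ker.1 hm, map_zero]
  have hcker : ∀ m ∈ ker p₂, c m ∈ derived 𝕜 L ⊓ Z.toSubmodule := fun m hm =>
    ⟨map_mem_derived c (h₂.ker_le hm).2, hmk.1 (by rw [hc, mem_ker.1 hm])⟩
  let β : ker p₁ →ₗ[𝕜] ker p₂ := (b : K₁ →ₗ[𝕜] K₂).restrict hbker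
  let γ : ker p₂ →ₗ[𝕜] (derived 𝕜 L ⊓ Z.toSubmodule : Submodule 𝕜 L) :=
    (c : K₂ →ₗ[𝕜] L).restrict hcker
  -- Both `c ∘ b` and `p₁` lie over the natural map to `L/Z`, so they differ by elements of `Z`,
  -- which are central.
  have hcb : ∀ x ∈ derived 𝕜 K₁, c (b x) = p₁ x := fun x hx =>
    eqOn_derived (c.comp b) p₁ (fun y => hkmk <| by
      change mkHom Z (c (b y) - p₁ y) = 0
      rw [map_sub, hc, hb, sub_self]) hx
  have hbsurj : ∀ y ∈ derived 𝕜 K₂, ∃ x ∈ derived 𝕜 K₁, b x = y := fun y hy =>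
    exists_mem_derived_map_eq b (fun k => by
      obtain ⟨l, hl⟩ := mkHom_surjective Z (p₂ k)
      obtain ⟨x, rfl⟩ := h₁.surjective l
      exact ⟨x, hk₂ (by rw [mem_ker, map_sub, hb, hl, sub_self])⟩) hy
  have hcsurj : ∀ y ∈ derived 𝕜 L, ∃ x ∈ derived 𝕜 K₂, c x = y := fun y hy =>
    exists_mem_derived_map_eq c (fun l => by
      obtain ⟨x, hx⟩ := h₂.surjective (mkHom Z l)
      exact ⟨x, hkmk (by rw [mem_ker, map_sub, hc, hx, sub_self])⟩) hy
  have hβθ : ∀ w, β (θ w) = 0 := by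
    have h : β ∘ₗ θ = 0 := by
      refine LinearMap.prod_ext (TensorProduct.ext' ?_) (TensorProduct.ext' ?_)
      · rintro l ⟨z, hz⟩
        obtain ⟨l, rfl⟩ := Submodule.Quotient.mk_surjective _ l
        obtain ⟨x, rfl⟩ := h₁.surjective l
        obtain ⟨t, rfl⟩ := h₁.surjective z
        refine Subtype.ext ?_
        change b (θ (Submodule.Quotient.mk (p₁ x) ⊗ₜ[𝕜] ⟨p₁ t, hz⟩, 0) : K₁) = 0
        rw [(hθ x t hz).1, map_mul]
        exact (hk₂ (by rw [mem_ker, hb, hmk.2 hz]) _).1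
      · rintro ⟨z, hz⟩ l
        obtain ⟨l, rfl⟩ := Submodule.Quotient.mk_surjective _ l
        obtain ⟨x, rfl⟩ := h₁.surjective l
        obtain ⟨t, rfl⟩ := h₁.surjective z
        refine Subtype.ext ?_
        change b (θ (0, ⟨p₁ t, hz⟩ ⊗ₜ[𝕜] Submodule.Quotient.mk (p₁ x)) : K₁) = 0
        rw [(hθ x t hz).2, map_mul]
        exact (hk₂ (by rw [mem_ker, hb, hmk.2 hz]) _).2
    exact LinearMap.congr_fun h
  refine ⟨θ, β, γ, hθ, ⟨b, NonUnitalAlgHom.ext hb⟩, ?_, ⟨c, NonUnitalAlgHom.ext hc⟩, ?_,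
    ?_, ?_, ?_⟩
  · intro b' hb' m
    refine eqOn_derived b b' (fun y => hk₂ ?_) (h₁.ker_le m.2).2
    have h : p₂ (b' y) = mkHom Z (p₁ y) := DFunLike.congr_fun hb' y
    rw [mem_ker, map_sub, hb, h, sub_self]
  · intro c' hc' m
    refine eqOn_derived c c' (fun y => hkmk ?_) (h₂.ker_le m.2).2
    have h : mkHom Z (c' y) = p₂ y := DFunLike.congr_fun hc' y
    rw [mem_ker, map_sub, hc, h, sub_self]
  · refine fun m => ⟨fun hm => ?_, ?_⟩
    -- The image of `θ` contains every `x * t` and `t * x` with `p₁ t` in `Z`, so the preimage of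
    -- `Z` becomes central in `K₁/T`.
    · let T : Submodule 𝕜 K₁ := (LinearMap.range θ).map (ker p₁).subtype
      have hTker : T ≤ ker p₁ := Submodule.map_subtype_le _ _
      let I := centralIdeal T fun x hx => (h₁.ker_le (hTker hx)).1
      let q : LQuot I →ₙₐ[𝕜] LQuot Z := liftHom I ((mkHom Z).comp p₁) fun x hx => by
        change mkHom Z (p₁ x) = 0
        rw [mem_ker.1 (hTker hx), map_zero]
      have hqmk : ∀ x, q (mkHom I x) = mkHom Z (p₁ x) := fun _ => rfl
      have hq : Function.Surjective q := fun y => by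
        obtain ⟨l, rfl⟩ := mkHom_surjective Z y
        obtain ⟨x, rfl⟩ := h₁.surjective l
        exact ⟨mkHom I x, rfl⟩
      have hqc : ker q ≤ center 𝕜 (LQuot I) := fun t ht y => by
        obtain ⟨t, rfl⟩ := mkHom_surjective I t
        obtain ⟨x, rfl⟩ := mkHom_surjective I y
        have htZ : p₁ t ∈ Z.toSubmodule := hmk.1 ht
        rw [← map_mul, ← map_mul, mkHom_eq_zero, mkHom_eq_zero]
        exact ⟨⟨_, ⟨_, rfl⟩, (hθ x t htZ).1⟩, ⟨_, ⟨_, rfl⟩, (hθ x t htZ).2⟩⟩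
      obtain ⟨d, hd⟩ := IsMaximalDefiningPair.exists_lift.{u, max u v, u} h₂ q hq hqc
        (NonUnitalAlgHom.id 𝕜 (LQuot Z))
      replace hd : ∀ x, q (d x) = p₂ x := hd
      -- Both maps `K₁ → K₁/T` lie over `L/Z`, so they agree on `K₁'`, which contains `m`. If `b m =
      -- 0`, then `m` lies in `T`.
      have h : d (b m) = mkHom I m := eqOn_derived (d.comp b) (mkHom I) (fun y => hqc <| by
        change q (d (b y) - mkHom I y) = 0
        rw [map_sub, hd, hb, hqmk, sub_self]) (h₁.ker_le m.2).2
      have hbm : b m = 0 := congrArg Subtype.val hm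
      rw [hbm, map_zero] at h
      obtain ⟨k, hk, hkm⟩ := mkHom_eq_zero.1 h.symm
      rw [← Subtype.ext hkm]
      exact hk
    · rintro ⟨w, rfl⟩
      exact hβθ w
  · refine fun m => ⟨fun hm => ?_, ?_⟩
    -- Taking the preimage in `K₁'` gives `p₁ x = c (b x) = c m = 0`, so `x` lies in `M(L)`.
    · obtain ⟨x, hx, hxm⟩ := hbsurj m (h₂.ker_le m.2).2
      have hcm : c m = 0 := congrArg Subtype.val hm
      refine ⟨⟨x, ?_⟩, Subtype.ext hxm⟩
      rw [mem_ker, ← hcb x hx, hxm, hcm]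
    · rintro ⟨k, rfl⟩
      refine Subtype.ext ?_
      change c (b k) = 0
      rw [hcb _ (h₁.ker_le k.2).2]
      exact mem_ker.1 k.2
  · rintro ⟨z, hzd, hz⟩
    obtain ⟨k, -, hk⟩ := hcsurj z hzd
    refine ⟨⟨k, ?_⟩, Subtype.ext hk⟩
    rw [mem_ker, ← hc, hk]
    exact hmk.2 hz
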